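/- A probability measure $\mu$ on $\mathbb{R}$, the law of a real random variable $X$, is said to be of Lee--Yang type, written $\mu\in\mathcal{L}$, if (1) $X$ and $-X$ have the same distribution; (2) $\mathbb{E}\big[e^{bX^2}\big]<\infty$ for some $b>0$; and (3) every zero $z\in\mathbb{C}$ of the moment generating function $z\mapsto\mathbb{E}\big[e^{zX}\big]$ is purely imaginary, i.e. satisfies $\operatorname{Re}z=0$. Theorem. Let $(\mu_n)_{n\in\mathbb{N}}$ be a sequence in $\mathcal{L}$ (the constant $b$ in (2) may depend on $n$) that converges weakly to a probability measure $\mu$ on $\mathbb{R}$. Then $\mu\in\mathcal{L}$. In particular, there is $c>0$ such that $\mu\big((r,\infty)\big)\le e^{-cr^2}$ for all $r\ge 0$. -/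

import Mathlib

open MeasureTheory ProbabilityTheory Filter Topology

/-- A probability measure `μ` on `ℝ`, the law of a random variable `X`, is of Lee-Yang type. -/
structure IsLeeYang (μ : ProbabilityMeasure ℝ) : Prop where
  /-- `X` and `-X` have the same distribution. -/
  symmetric : (μ : Measure ℝ).map (fun x : ℝ => -x) = (μ : Measure ℝ)
  /-- `𝔼 exp (b X²) < ∞` for some `b > 0`. -/
  exp_sq_integrable : ∃ b : ℝ, 0 < b ∧ Integrable (fun x : ℝ => Real.exp (b * x ^ 2)) (μ : Measure ℝ)
  /-- All the zeros of `z ↦ 𝔼 exp (z X)` lie on the imaginary axis; the expectation converges for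
  every complex `z` by the previous field. -/
  zeros_imaginary : ∀ z : ℂ, complexMGF (fun x : ℝ => x) (μ : Measure ℝ) z = 0 → z.re = 0

/-- The Lee-Yang class `𝓛`. -/
def leeYangClass : Set (ProbabilityMeasure ℝ) := {μ | IsLeeYang μ}

/-! The heart is a sub-Gaussian bound for Lee–Yang measures that depends only on the characteristic
function near 0. The moment generating function is even, hence equals g(z²) with g entire; condition
(2) gives g exponential type, and (3) puts its zeros at negative reals -a. By Hadamard, g(w) =
exp(βw) ∏ (1 + w/a). If every a > s, then log(1 + u) ≤ u at u = x/a and u = -s/a gives log g(x)/x +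
log g(-s)/s ≤ 0 for x > 0, the β terms cancelling. Here g(-s) is the characteristic function at √s,
and g(t²) = E exp(tX).

Hadamard's theorem is replaced by a finite version: divide out the zeros in a disc of radius R; the
quotient has a logarithm h there with Re h = O(R), so by Borel–Carathéodory and Schwarz h(w)/w
changes by only O(1/R) between -s and x.

Weak convergence keeps the characteristic functions above 1/2 on a common neighbourhood of 0 for
large n, which excludes zeros there and gives one variance proxy for the whole tail. That bound
passes to the limit, yields (2) and the tail estimate, and makes the generating functions locally
bounded and convergent. Hurwitz's theorem off the imaginary axis then gives (3). -/

/-! ### Even entire functions and division of zeros -/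

/-- An even entire function is an entire function of `z ^ 2`. -/
theorem Differentiable.exists_comp_sq_of_even {f : ℂ → ℂ} (hf : Differentiable ℂ f)
    (heven : ∀ z, f (-z) = f z) : ∃ g : ℂ → ℂ, Differentiable ℂ g ∧ ∀ z, g (z ^ 2) = f z := by
  have key : ∀ a b : ℂ, a ^ 2 = b ^ 2 → f a = f b := by
    intro a b hab
    rcases sq_eq_sq_iff_eq_or_eq_neg.1 hab with h | h
    · rw [h]
    · rw [h, heven]
  have hsq : ∀ w : ℂ, (w ^ (1 / 2 : ℂ)) ^ 2 = w := fun w => by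
    simp
  set g : ℂ → ℂ := fun w => f (w ^ (1 / 2 : ℂ)) with hgdef
  have hd : ∀ w ≠ 0, DifferentiableAt ℂ g w := by
    intro w hw
    by_cases hs : w ∈ Complex.slitPlane
    · exact (hf _).comp w (differentiableAt_id.cpow_const hs)
    · have hs' : -w ∈ Complex.slitPlane := by
        rw [Complex.mem_slitPlane_iff] at hs ⊢
        push Not at hs
        left
        rcases hs.1.lt_or_eq with h | h
        · simpa using h
        · exact absurd (Complex.ext h hs.2) hw
      -- On the branch cut, the root `I * (-w) ^ (1/2)` is holomorphic instead; evenness makes the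
      -- choice of root immaterial.
      have hg' : g = fun w => f (Complex.I * (-w) ^ (1 / 2 : ℂ)) := by
        funext v
        apply key
        rw [hsq, mul_pow, hsq, Complex.I_sq]
        ring
      rw [hg']
      exact (hf _).comp w
        ((differentiableAt_const _).mul (differentiableAt_id.neg.cpow_const hs'))
  have hc : ContinuousAt g 0 := by
    have h1 : ContinuousAt (fun w : ℂ => w ^ (1 / 2 : ℂ)) 0 := by
      rw [ContinuousAt, Complex.zero_cpow (by norm_num), tendsto_zero_iff_norm_tendsto_zero]
      have h2 : ∀ w : ℂ, ‖w ^ (1 / 2 : ℂ)‖ = Real.sqrt ‖w‖ := fun w => by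
        rw [eq_comm, Real.sqrt_eq_iff_mul_self_eq (norm_nonneg _) (norm_nonneg _), ← norm_mul,
          ← sq, hsq]
      simp only [h2]
      have h3 : Continuous fun w : ℂ => Real.sqrt ‖w‖ := by fun_prop
      simpa using h3.tendsto 0
    exact ContinuousAt.comp (g := f) hf.continuous.continuousAt h1
  refine ⟨g, fun w => ?_, fun z => key _ _ (hsq _)⟩
  rcases eq_or_ne w 0 with rfl | hw
  · exact (Complex.analyticAt_of_differentiable_on_punctured_nhds_of_continuousAt
      (eventually_nhdsWithin_of_forall fun z hz => hd z hz) hc).differentiableAt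
  · exact hd w hw

/-- An entire function that does not vanish identically is, around any point `t`, a power of
`w - t` times an entire function that is nonzero at `t`. -/
theorem Differentiable.exists_eq_pow_mul {F : ℂ → ℂ} (hF : Differentiable ℂ F) {w₀ : ℂ}
    (h0 : F w₀ ≠ 0) (t : ℂ) :
    ∃ (n : ℕ) (H : ℂ → ℂ), Differentiable ℂ H ∧ H t ≠ 0 ∧ ∀ w, F w = (w - t) ^ n * H w := by
  obtain ⟨p, hp⟩ := hF.analyticAt t
  have hp0 : p ≠ 0 := by
    intro h
    have h1 := hp.locally_zero_iff.2 h
    have h2 := (hF.differentiableOn.analyticOnNhd isOpen_univ).eqOn_zero_of_preconnected_of_eventuallyEq_zero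
      isPreconnected_univ (Set.mem_univ t) h1
    exact h0 (h2 (Set.mem_univ w₀))
  refine ⟨p.order, _, ?_, hp.iterate_dslope_fslope_ne_zero hp0,
    fun w => hp.eq_pow_order_mul_iterate_dslope w⟩
  generalize p.order = n
  induction n with
  | zero => simpa using hF
  | succ n ih =>
    rw [Function.iterate_succ_apply', ← differentiableOn_univ]
    exact (Complex.differentiableOn_dslope univ_mem).2 ih.differentiableOn

/-- Finitely many zeros of an entire function can be divided out. -/
theorem Differentiable.exists_multiset_prod_mul {g : ℂ → ℂ} (hg : Differentiable ℂ g)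
    (h0 : g 0 ≠ 0) (T : Finset ℂ) :
    ∃ (S : Multiset ℂ) (F : ℂ → ℂ), Differentiable ℂ F ∧ (∀ a ∈ S, g a = 0 ∧ a ∈ T) ∧
      (∀ w, g w = (S.map fun a => 1 - w / a).prod * F w) ∧ ∀ a ∈ T, F a ≠ 0 := by
  classical
  induction T using Finset.induction_on with
  | empty => exact ⟨0, g, hg, by simp, by simp, by simp⟩
  | insert t T _ ih =>
    obtain ⟨S, F, hF, hS, hgF, hFT⟩ := ih
    have hF0 : F 0 ≠ 0 := fun h => h0 (by rw [hgF, h, mul_zero])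
    by_cases ht : F t = 0
    · obtain ⟨n, H, hH, hHt, hFH⟩ := hF.exists_eq_pow_mul hF0 t
      have hgt : g t = 0 := by rw [hgF, ht, mul_zero]
      have ht0 : t ≠ 0 := fun h => h0 (h ▸ hgt)
      refine ⟨S + Multiset.replicate n t, fun w => (-t) ^ n * H w, hH.const_mul _, ?_, ?_, ?_⟩
      · intro a ha
        rcases Multiset.mem_add.1 ha with ha | ha
        · exact ⟨(hS a ha).1, Finset.mem_insert_of_mem (hS a ha).2⟩
        · rw [Multiset.eq_of_mem_replicate ha]
          exact ⟨hgt, Finset.mem_insert_self _ _⟩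
      · intro w
        have h1 : w - t = (1 - w / t) * (-t) := by field_simp; ring
        rw [hgF, hFH, h1, mul_pow, Multiset.map_add, Multiset.prod_add, Multiset.map_replicate,
          Multiset.prod_replicate]
        ring
      · intro a ha
        refine mul_ne_zero (pow_ne_zero _ (neg_ne_zero.2 ht0)) ?_
        rcases Finset.mem_insert.1 ha with rfl | ha
        · exact hHt
        · exact fun h => hFT a ha (by rw [hFH, h, mul_zero])
    · refine ⟨S, F, hF, fun a ha => ⟨(hS a ha).1, Finset.mem_insert_of_mem (hS a ha).2⟩, hgF, ?_⟩
      intro a ha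
      rcases Finset.mem_insert.1 ha with rfl | ha
      · exact ht
      · exact hFT a ha

/-- The zeros of an entire function in a closed disc can be divided out. -/
theorem Differentiable.exists_multiset_prod_mul_closedBall {g : ℂ → ℂ} (hg : Differentiable ℂ g)
    (h0 : g 0 ≠ 0) (R : ℝ) :
    ∃ (S : Multiset ℂ) (F : ℂ → ℂ), Differentiable ℂ F ∧ (∀ a ∈ S, g a = 0 ∧ ‖a‖ ≤ R) ∧
      (∀ w, g w = (S.map fun a => 1 - w / a).prod * F w) ∧ ∀ w, ‖w‖ ≤ R → F w ≠ 0 := by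
  have hcod : g ⁻¹' {0}ᶜ ∈ codiscrete ℂ :=
    (hg.differentiableOn.analyticOnNhd isOpen_univ).preimage_zero_mem_codiscrete h0
  have hfin : (Metric.closedBall (0 : ℂ) R \ g ⁻¹' {0}ᶜ).Finite :=
    (isCompact_closedBall (0 : ℂ) R).finite_sdiff_of_mem_codiscreteWithin
      (Filter.codiscreteWithin_mono (Set.subset_univ _) hcod)
  obtain ⟨S, F, hF, hS, hgF, hFT⟩ := hg.exists_multiset_prod_mul h0 hfin.toFinset
  refine ⟨S, F, hF, fun a ha => ⟨(hS a ha).1, ?_⟩, hgF, fun w hw h => ?_⟩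
  · have := (hS a ha).2
    rw [Set.Finite.mem_toFinset] at this
    simpa using this.1
  · refine hFT w ?_ h
    rw [Set.Finite.mem_toFinset]
    have : g w = 0 := by rw [hgF, h, mul_zero]
    simp [hw, this]

/-! ### Holomorphic logarithms with one-sided bounds -/

/-- A zero-free holomorphic function on a disc has a holomorphic logarithm. -/
theorem Complex.exists_exp_eq_of_ne_zero_ball {F : ℂ → ℂ} (hF : Differentiable ℂ F) {R : ℝ}
    (hR : 0 < R) (hne : ∀ w ∈ Metric.ball (0 : ℂ) R, F w ≠ 0) (h1 : F 0 = 1) :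
    ∃ h : ℂ → ℂ, DifferentiableOn ℂ h (Metric.ball 0 R) ∧ h 0 = 0 ∧
      ∀ w ∈ Metric.ball (0 : ℂ) R, Complex.exp (h w) = F w := by
  have hF' : Differentiable ℂ (deriv F) := fun z => (hF.analyticAt z).deriv.differentiableAt
  have hq : DifferentiableOn ℂ (fun w => deriv F w / F w) (Metric.ball 0 R) :=
    hF'.differentiableOn.div hF.differentiableOn hne
  obtain ⟨h, hh0, hh⟩ := hq.isExactOn_ball.with_val_at 0 0
  refine ⟨h, fun w hw => (hh w hw).differentiableAt.differentiableWithinAt, hh0, fun w hw => ?_⟩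
  have hconst : ∀ v ∈ Metric.ball (0 : ℂ) R,
      HasDerivAt (fun v => F v * Complex.exp (-h v)) 0 v := by
    intro v hv
    have := (hF v).hasDerivAt.mul ((hh v hv).neg.cexp)
    convert! this using 1
    have := hne v hv
    field_simp
    ring
  have heq := (convex_ball (0 : ℂ) R).is_const_of_fderivWithin_eq_zero (𝕜 := ℂ)
    (f := fun v => F v * Complex.exp (-h v))
    (fun v hv => (hconst v hv).differentiableAt.differentiableWithinAt)
    (fun v hv => by
      have := (hconst v hv).hasFDerivAt.hasFDerivWithinAt (s := Metric.ball 0 R)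
      rw [this.fderivWithin (Metric.isOpen_ball.uniqueDiffWithinAt hv)]
      ext; simp) hw (Metric.mem_ball_self hR)
  simp only [hh0, h1, neg_zero, Complex.exp_zero, mul_one, Complex.exp_neg] at heq
  field_simp at heq
  exact heq.symm

/-- If `h 0 = 0` and `Re h ≤ M` on a disc of large radius then `h z / z` is nearly constant. -/
theorem Complex.norm_div_sub_div_le_of_re_le {h : ℂ → ℂ} {R M : ℝ} (hR : 0 < R) (hM : 0 < M)
    (hd : DifferentiableOn ℂ h (Metric.ball 0 R)) (h0 : h 0 = 0)
    (hre : ∀ w ∈ Metric.ball (0 : ℂ) R, (h w).re ≤ M) {x y : ℂ} (hx : x ≠ 0) (hy : y ≠ 0)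
    (hxR : ‖x‖ < R / 8) (hyR : ‖y‖ < R / 8) :
    ‖h x / x - h y / y‖ ≤ 32 * M * ‖x - y‖ / R ^ 2 := by
  have hsub : Metric.ball (0 : ℂ) (R / 2) ⊆ Metric.ball 0 R :=
    Metric.ball_subset_ball (by linarith)
  -- Borel–Carathéodory: 2M‖w‖/(R - ‖w‖) ≤ 2M on the half disc.
  have hb : ∀ w ∈ Metric.ball (0 : ℂ) (R / 2), ‖h w‖ ≤ 2 * M := by
    intro w hw
    refine (Complex.borelCaratheodory_zero hM hd hre hR (hsub hw) h0).trans ?_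
    rw [mem_ball_zero_iff] at hw
    rw [div_le_iff₀ (by linarith)]
    nlinarith
  have hq : ∀ w ∈ Metric.ball (0 : ℂ) (R / 2), ‖dslope h 0 w‖ ≤ 2 * M / (R / 2) := fun w hw =>
    Complex.norm_dslope_le_div_of_mapsTo_ball (hd.mono hsub)
      (fun v hv => by simpa [h0] using hb v hv) hw
  have hqd : DifferentiableOn ℂ (dslope h 0) (Metric.ball 0 R) :=
    (Complex.differentiableOn_dslope (Metric.ball_mem_nhds _ hR)).2 hd
  have hsub' : Metric.ball y (R / 4) ⊆ Metric.ball 0 (R / 2) :=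
    Metric.ball_subset_ball' (by rw [dist_zero_right]; linarith)
  have hxy : x ∈ Metric.ball y (R / 4) := by
    rw [Metric.mem_ball, dist_eq_norm]
    linarith [norm_sub_le x y]
  have hyb : y ∈ Metric.ball (0 : ℂ) (R / 2) := by
    rw [mem_ball_zero_iff]; linarith
  -- Schwarz again: h(w)/w is at most 4M/R in norm, so it oscillates by at most 8M/R on a disc of
  -- radius R/4, whence 32M/R².
  have := Complex.dist_le_div_mul_dist_of_mapsTo_ball (R₂ := 2 * (2 * M / (R / 2)))
    (hqd.mono (hsub'.trans hsub))
    (fun v hv => by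
      rw [Metric.mem_closedBall, dist_eq_norm]
      linarith [norm_sub_le (dslope h 0 v) (dslope h 0 y), hq v (hsub' hv), hq y hyb]) hxy
  rw [dslope_of_ne _ hx, dslope_of_ne _ hy, dist_eq_norm, dist_eq_norm] at this
  simp only [slope_def_field, h0, sub_zero] at this
  refine this.trans (le_of_eq ?_)
  field_simp
  ring

/-! ### The chord inequality -/

/-- For a product of factors `1 + w / a` with `a > s > 0`, the logarithm lies below the chord
through `-s` and `0`. -/
theorem Multiset.log_norm_prod_one_sub_div_le {S : Multiset ℂ} {s x : ℝ} (hs : 0 < s) (hx : 0 < x)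
    (hS : ∀ b ∈ S, ∃ a : ℝ, s < a ∧ b = -(a : ℂ)) :
    Real.log ‖(S.map fun b => 1 - (x : ℂ) / b).prod‖ / x +
      Real.log ‖(S.map fun b => 1 - ((-s : ℝ) : ℂ) / b).prod‖ / s ≤ 0 := by
  have hfac : ∀ b ∈ S, 0 < ‖1 - (x : ℂ) / b‖ ∧ 0 < ‖1 - ((-s : ℝ) : ℂ) / b‖ ∧
      Real.log ‖1 - (x : ℂ) / b‖ / x + Real.log ‖1 - ((-s : ℝ) : ℂ) / b‖ / s ≤ 0 := by
    intro b hb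
    obtain ⟨a, ha, rfl⟩ := hS b hb
    have ha0 : 0 < a := hs.trans ha
    have e1 : 1 - (x : ℂ) / (-(a : ℂ)) = ((1 + x / a : ℝ) : ℂ) := by
      push_cast; rw [div_neg]; ring
    have e2 : 1 - ((-s : ℝ) : ℂ) / (-(a : ℂ)) = ((1 - s / a : ℝ) : ℂ) := by
      push_cast; rw [neg_div_neg_eq]
    have p1 : 0 < 1 + x / a := by positivity
    have p2 : 0 < 1 - s / a := sub_pos.2 ((div_lt_one ha0).2 ha)
    rw [e1, e2, Complex.norm_real, Complex.norm_real, Real.norm_of_nonneg p1.le,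
      Real.norm_of_nonneg p2.le]
    refine ⟨p1, p2, ?_⟩
    -- Both bounds are log u ≤ u - 1; the linear terms 1/a and -1/a cancel.
    have l1 : Real.log (1 + x / a) / x ≤ 1 / a := by
      rw [div_le_iff₀ hx]
      refine (Real.log_le_sub_one_of_pos p1).trans (le_of_eq ?_)
      ring
    have l2 : Real.log (1 - s / a) / s ≤ -(1 / a) := by
      rw [div_le_iff₀ hs]
      refine (Real.log_le_sub_one_of_pos p2).trans (le_of_eq ?_)
      ring
    linarith
  have key : ∀ T : Multiset ℂ, T ≤ S → 0 < ‖(T.map fun b => 1 - (x : ℂ) / b).prod‖ ∧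
      0 < ‖(T.map fun b => 1 - ((-s : ℝ) : ℂ) / b).prod‖ ∧
      Real.log ‖(T.map fun b => 1 - (x : ℂ) / b).prod‖ / x +
      Real.log ‖(T.map fun b => 1 - ((-s : ℝ) : ℂ) / b).prod‖ / s ≤ 0 := by
    intro T
    induction T using Multiset.induction_on with
    | empty => simp
    | cons b T ih =>
      intro hT
      obtain ⟨q1, q2, q3⟩ := ih ((Multiset.le_cons_self T b).trans hT)
      obtain ⟨p1, p2, p3⟩ := hfac b (Multiset.mem_of_le hT (Multiset.mem_cons_self b T))
      simp only [Multiset.map_cons, Multiset.prod_cons, norm_mul]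
      refine ⟨mul_pos p1 q1, mul_pos p2 q2, ?_⟩
      rw [Real.log_mul p1.ne' q1.ne', Real.log_mul p2.ne' q2.ne', add_div, add_div]
      linarith
  exact (key S le_rfl).2.2

/-- At twice the radius of the zeros each |w/b| is at least 2. This lets the quotient inherit the
growth bound of g on that circle. -/
theorem Multiset.one_le_norm_prod_one_sub_div {S : Multiset ℂ} {R : ℝ} {w : ℂ}
    (hS : ∀ b ∈ S, b ≠ 0 ∧ ‖b‖ ≤ R) (hw : ‖w‖ = 2 * R) :
    1 ≤ ‖(S.map fun b => 1 - w / b).prod‖ := by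
  induction S using Multiset.induction_on with
  | empty => simp
  | cons b S ih =>
    rw [Multiset.map_cons, Multiset.prod_cons, norm_mul]
    refine one_le_mul_of_one_le_of_one_le ?_ (ih fun c hc => hS c (Multiset.mem_cons_of_mem hc))
    obtain ⟨hb, hbR⟩ := hS b (Multiset.mem_cons_self b S)
    have h1 : 2 ≤ ‖w / b‖ := by
      rw [norm_div, hw, le_div_iff₀ (norm_pos_iff.2 hb)]
      linarith
    have h2 := norm_sub_norm_le (w / b) 1
    rw [norm_one, norm_sub_rev] at h2
    linarith

/-- For an entire function `g` of exponential type with `g 0 = 1`, all whose zeros lie in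
`(-∞, -s)`, the function `log |g|` on the positive half-line lies below its chord through `-s`
and `0`. -/
theorem Differentiable.log_norm_div_add_log_norm_div_nonpos {g : ℂ → ℂ} (hg : Differentiable ℂ g)
    (h1 : g 0 = 1) {A B : ℝ} (hA : 0 ≤ A) (hB : 0 ≤ B)
    (hgrow : ∀ w, ‖g w‖ ≤ Real.exp (A + B * ‖w‖)) {s : ℝ} (hs : 0 < s)
    (hz : ∀ w, g w = 0 → ∃ a : ℝ, s < a ∧ w = -(a : ℂ)) {x : ℝ} (hx : 0 < x) :
    Real.log ‖g x‖ / x + Real.log ‖g ((-s : ℝ) : ℂ)‖ / s ≤ 0 := by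
  -- The threshold puts x and -s inside the disc of radius R/8 where h(w)/w is controlled.
  have main : ∀ R : ℝ, 8 * x + 8 * s < R →
      Real.log ‖g x‖ / x + Real.log ‖g ((-s : ℝ) : ℂ)‖ / s ≤
        32 * (A + B * (2 * R) + 1) * (x + s) / R ^ 2 := by
    intro R hR
    have hR0 : 0 < R := by linarith
    obtain ⟨S, F, hF, hS, hgF, hFne⟩ :=
      hg.exists_multiset_prod_mul_closedBall (by simp [h1]) R
    have hF0 : F 0 = 1 := by
      have := hgF 0
      simpa [h1] using this.symm
    have hS' : ∀ b ∈ S, b ≠ 0 ∧ ‖b‖ ≤ R := fun b hb =>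
      ⟨fun h => by simpa [h, h1] using (hS b hb).1, (hS b hb).2⟩
    -- Maximum principle: on the circle of radius 2R the divided product has norm at least 1, so |F|
    -- ≤ |g| there.
    have hFb : ∀ w, ‖w‖ ≤ 2 * R → ‖F w‖ ≤ Real.exp (A + B * (2 * R)) := by
      intro w hw
      refine Complex.norm_le_of_forall_mem_frontier_norm_le (U := Metric.ball (0 : ℂ) (2 * R))
        Metric.isBounded_ball hF.diffContOnCl ?_ ?_
      · intro v hv
        rw [frontier_ball _ (by positivity), mem_sphere_zero_iff_norm] at hv
        have hP := Multiset.one_le_norm_prod_one_sub_div hS' hv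
        have hgv := hgrow v
        rw [hgF v, norm_mul, hv] at hgv
        nlinarith [norm_nonneg (F v)]
      · rw [closure_ball _ (by positivity), mem_closedBall_zero_iff]
        exact hw
    obtain ⟨h, hh, hh0, hexp⟩ := Complex.exists_exp_eq_of_ne_zero_ball hF hR0
      (fun w hw => hFne w (mem_ball_zero_iff.1 hw).le) hF0
    have hre : ∀ w ∈ Metric.ball (0 : ℂ) R, (h w).re = Real.log ‖F w‖ := fun w hw => by
      rw [← hexp w hw, Complex.norm_exp, Real.log_exp]
    -- The `+ 1` makes the bound strictly positive, as Borel–Carathéodory requires.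
    have hreM : ∀ w ∈ Metric.ball (0 : ℂ) R, (h w).re ≤ A + B * (2 * R) + 1 := by
      intro w hw
      have h2 := hFb w (by linarith [mem_ball_zero_iff.1 hw])
      rw [← hexp w hw, Complex.norm_exp, Real.exp_le_exp] at h2
      linarith
    have hnx : ‖(x : ℂ)‖ = x := by rw [Complex.norm_real, Real.norm_of_nonneg hx.le]
    have hns : ‖((-s : ℝ) : ℂ)‖ = s := by
      rw [Complex.norm_real, norm_neg, Real.norm_of_nonneg hs.le]
    have hxb : (x : ℂ) ∈ Metric.ball (0 : ℂ) R := by rw [mem_ball_zero_iff, hnx]; linarith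
    have hsb : ((-s : ℝ) : ℂ) ∈ Metric.ball (0 : ℂ) R := by rw [mem_ball_zero_iff, hns]; linarith
    have hdiff := Complex.norm_div_sub_div_le_of_re_le hR0 (by positivity) hh hh0 hreM
      (x := (x : ℂ)) (y := ((-s : ℝ) : ℂ)) (by simpa using hx.ne') (by simpa using hs.ne')
      (by rw [hnx]; linarith) (by rw [hns]; linarith)
    have hxs : ‖(x : ℂ) - ((-s : ℝ) : ℂ)‖ = x + s := by
      rw [← Complex.ofReal_sub, Complex.norm_real, sub_neg_eq_add, Real.norm_of_nonneg (by positivity)]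
    rw [hxs] at hdiff
    have hre2 := (Complex.re_le_norm _).trans hdiff
    rw [Complex.sub_re, Complex.div_ofReal_re, Complex.div_ofReal_re, hre _ hxb, hre _ hsb] at hre2
    have hPle := Multiset.log_norm_prod_one_sub_div_le hs hx fun b hb => hz b (hS b hb).1
    have hlog : ∀ w, g w ≠ 0 → Real.log ‖g w‖ =
        Real.log ‖(S.map fun a => 1 - w / a).prod‖ + Real.log ‖F w‖ := by
      intro w hw
      have hw' := hw
      rw [hgF w] at hw'
      rw [hgF w, norm_mul, Real.log_mul (norm_ne_zero_iff.2 (left_ne_zero_of_mul hw'))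
        (norm_ne_zero_iff.2 (right_ne_zero_of_mul hw'))]
    have hgx : g x ≠ 0 := by
      intro h
      obtain ⟨a, ha, hxa⟩ := hz _ h
      have : x = -a := by exact_mod_cast hxa
      linarith
    have hgs : g ((-s : ℝ) : ℂ) ≠ 0 := by
      intro h
      obtain ⟨a, ha, hxa⟩ := hz _ h
      have : -s = -a := by exact_mod_cast hxa
      linarith
    rw [hlog _ hgx, hlog _ hgs, add_div, add_div]
    rw [div_neg] at hre2
    linarith
  -- Exponential type makes the numerator linear in R, so R² wins.
  have hlim : Tendsto (fun R : ℝ => 32 * (A + B * (2 * R) + 1) * (x + s) / R ^ 2) atTop (𝓝 0) := by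
    have hinv := tendsto_inv_atTop_zero (𝕜 := ℝ)
    have h2 : Tendsto (fun R : ℝ => 32 * (A + 1) * (x + s) * (R⁻¹ * R⁻¹) +
        64 * B * (x + s) * R⁻¹) atTop (𝓝 (32 * (A + 1) * (x + s) * (0 * 0) +
        64 * B * (x + s) * 0)) :=
      ((hinv.mul hinv).const_mul _).add (hinv.const_mul _)
    simp only [mul_zero, add_zero] at h2
    refine h2.congr' ?_
    filter_upwards [eventually_gt_atTop 0] with R hR
    field_simp
    ring
  exact ge_of_tendsto hlim ((eventually_gt_atTop (8 * x + 8 * s)).mono main)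

/-! ### Convergence of entire functions and Hurwitz's theorem -/

/-- A locally bounded sequence of entire functions that converges pointwise converges uniformly on
compact sets. -/
theorem tendstoUniformlyOn_of_differentiable_of_norm_le {f : ℕ → ℂ → ℂ} {g : ℂ → ℂ}
    (hf : ∀ n, Differentiable ℂ (f n)) (hlim : ∀ z, Tendsto (fun n => f n z) atTop (𝓝 (g z)))
    (hbd : ∀ r : ℝ, ∃ M : ℝ, ∀ n z, ‖z‖ ≤ r → ‖f n z‖ ≤ M) {K : Set ℂ} (hK : IsCompact K) :
    TendstoUniformlyOn f g atTop K := by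
  have heq : Equicontinuous f := by
    intro z
    obtain ⟨M, hM⟩ := hbd (‖z‖ + 1)
    have hball : ∀ w ∈ Metric.ball z 1, ‖w‖ ≤ ‖z‖ + 1 := fun w hw => by
      have h1 : ‖w - z‖ < 1 := by simpa [dist_eq_norm] using hw
      linarith [norm_le_norm_add_norm_sub' w z]
    refine Metric.equicontinuousAt_of_continuity_modulus (fun w => 2 * M / 1 * dist w z) ?_ f ?_
    · have : Continuous fun w => 2 * M / 1 * dist w z := by fun_prop
      simpa using this.tendsto z
    · filter_upwards [Metric.ball_mem_nhds z one_pos] with w hw n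
      rw [dist_comm]
      refine Complex.dist_le_div_mul_dist_of_mapsTo_ball (hf n).differentiableOn (fun v hv => ?_) hw
      rw [Metric.mem_closedBall, dist_eq_norm]
      linarith [norm_sub_le (f n v) (f n z), hM n v (hball v hv), hM n z (by linarith)]
  have := (EquicontinuousOn.tendsto_uniformOnFun_iff_pi' (𝔖 := {K}) (by simpa using hK)
    (fun K _ => heq.equicontinuousOn K) atTop g).2
    (tendsto_pi_nhds.2 fun z => hlim z)
  exact UniformOnFun.tendsto_iff_tendstoUniformlyOn.1 this K rfl

/-- **Hurwitz's theorem** for locally bounded, pointwise convergent sequences of entire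
functions. -/
theorem Complex.ne_zero_of_tendsto_of_ne_zero {f : ℕ → ℂ → ℂ} {g : ℂ → ℂ}
    (hf : ∀ n, Differentiable ℂ (f n)) (hg : Differentiable ℂ g)
    (hlim : ∀ z, Tendsto (fun n => f n z) atTop (𝓝 (g z)))
    (hbd : ∀ r : ℝ, ∃ M : ℝ, ∀ n z, ‖z‖ ≤ r → ‖f n z‖ ≤ M) {U : Set ℂ} (hU : IsOpen U)
    (hne : ∀ n, ∀ z ∈ U, f n z ≠ 0) {w : ℂ} (hw : g w ≠ 0) {z : ℂ} (hz : z ∈ U) : g z ≠ 0 := by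
  intro hgz
  have hev : ∀ᶠ v in 𝓝[≠] z, g v ≠ 0 := by
    rcases (hg.analyticAt z).eventually_eq_zero_or_eventually_ne_zero with h | h
    · exact absurd ((hg.differentiableOn.analyticOnNhd
        isOpen_univ).eqOn_zero_of_preconnected_of_eventuallyEq_zero isPreconnected_univ
        (Set.mem_univ z) h (Set.mem_univ w)) hw
    · exact h
  rw [eventually_nhdsWithin_iff] at hev
  obtain ⟨ρ, hρ, hball⟩ := Metric.nhds_basis_closedBall.mem_iff.1
    (inter_mem hev (hU.mem_nhds hz))
  have hsph : ∀ v ∈ Metric.sphere z ρ, g v ≠ 0 := fun v hv =>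
    (hball (Metric.sphere_subset_closedBall hv)).1 (by
      rintro rfl
      simp at hv
      exact hρ.ne hv)
  obtain ⟨v₀, hv₀, hmin⟩ := (isCompact_sphere z ρ).exists_isMinOn
    (NormedSpace.sphere_nonempty.2 hρ.le) hg.continuous.norm.continuousOn
  set m := ‖g v₀‖ with hm
  have hm0 : 0 < m := norm_pos_iff.2 (hsph v₀ hv₀)
  have hunif := tendstoUniformlyOn_of_differentiable_of_norm_le hf hlim hbd (isCompact_sphere z ρ)
  -- The maximum principle for 1/f_n carries the lower bound from the circle to its centre,
  -- contradicting f_n(z) → 0.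
  have hlow : ∀ᶠ n in atTop, m / 2 ≤ ‖f n z‖ := by
    filter_upwards [Metric.tendstoUniformlyOn_iff.1 hunif (m / 2) (by positivity)] with n hn
    have hfne : ∀ v ∈ closure (Metric.ball z ρ), f n v ≠ 0 := fun v hv => by
      rw [closure_ball _ hρ.ne'] at hv
      exact hne n v (hball hv).2
    have hfr : ∀ v ∈ frontier (Metric.ball z ρ), ‖(f n v)⁻¹‖ ≤ (m / 2)⁻¹ := by
      intro v hv
      rw [frontier_ball _ hρ.ne'] at hv
      have h1 := hn v hv
      have h2 : m ≤ ‖g v‖ := hmin hv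
      rw [dist_eq_norm] at h1
      rw [norm_inv]
      apply inv_anti₀ (by positivity)
      linarith [norm_le_norm_add_norm_sub (f n v) (g v), norm_sub_rev (f n v) (g v)]
    have := Complex.norm_le_of_forall_mem_frontier_norm_le Metric.isBounded_ball
      ((hf n).diffContOnCl.inv hfne) hfr (subset_closure (Metric.mem_ball_self hρ))
    rw [Pi.inv_apply, norm_inv] at this
    exact (inv_le_inv₀ (norm_pos_iff.2 (hne n z hz)) (by positivity)).1 this
  have := ge_of_tendsto (hlim z).norm hlow
  rw [hgz, norm_zero] at this
  linarith

/-! ### Sub-Gaussian bound for Lee–Yang measures -/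

theorem ProbabilityTheory.differentiable_complexMGF {Ω : Type*} {mΩ : MeasurableSpace Ω}
    {X : Ω → ℝ} {μ : Measure Ω} (h : ∀ t : ℝ, Integrable (fun ω => Real.exp (t * X ω)) μ) :
    Differentiable ℂ (complexMGF X μ) := by
  have huniv : integrableExpSet X μ = Set.univ := Set.eq_univ_of_forall h
  rw [← differentiableOn_univ]
  simpa [huniv] using differentiableOn_complexMGF (X := X) (μ := μ)

theorem mul_le_sq_add_sq_div {b : ℝ} (hb : 0 < b) (t x : ℝ) :
    t * x ≤ b * x ^ 2 + t ^ 2 / (4 * b) := by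
  have h : b * x ^ 2 + t ^ 2 / (4 * b) - t * x = b * (x - t / (2 * b)) ^ 2 := by
    field_simp; ring
  nlinarith [mul_nonneg hb.le (sq_nonneg (x - t / (2 * b)))]

namespace IsLeeYang

variable {μ : ProbabilityMeasure ℝ}

theorem integrable_exp_mul (hμ : IsLeeYang μ) (t : ℝ) :
    Integrable (fun x : ℝ => Real.exp (t * x)) (μ : Measure ℝ) := by
  obtain ⟨b, hb, hint⟩ := hμ.exp_sq_integrable
  refine (hint.mul_const (Real.exp (t ^ 2 / (4 * b)))).mono' (by fun_prop) (.of_forall fun x => ?_)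
  rw [Real.norm_of_nonneg (Real.exp_pos _).le, ← Real.exp_add, Real.exp_le_exp]
  exact mul_le_sq_add_sq_div hb t x

/-- The moment generating function of a Lee-Yang measure has order at most two. -/
theorem exists_norm_complexMGF_le (hμ : IsLeeYang μ) :
    ∃ A B : ℝ, 0 ≤ A ∧ 0 ≤ B ∧ ∀ z : ℂ,
      ‖complexMGF (fun x : ℝ => x) (μ : Measure ℝ) z‖ ≤ Real.exp (A + B * ‖z‖ ^ 2) := by
  obtain ⟨b, hb, hint⟩ := hμ.exp_sq_integrable
  set C := ∫ x : ℝ, Real.exp (b * x ^ 2) ∂(μ : Measure ℝ) with hC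
  have hC0 : 0 ≤ C := integral_nonneg fun x => (Real.exp_pos _).le
  refine ⟨C, 1 / (4 * b), hC0, by positivity, fun z => ?_⟩
  refine norm_complexMGF_le_mgf.trans ?_
  calc mgf (fun x : ℝ => x) (μ : Measure ℝ) z.re
      ≤ ∫ x : ℝ, Real.exp (b * x ^ 2) * Real.exp (z.re ^ 2 / (4 * b)) ∂(μ : Measure ℝ) := by
        refine integral_mono (hμ.integrable_exp_mul z.re) (hint.mul_const _) fun x => ?_
        simp only [← Real.exp_add]
        exact Real.exp_le_exp.2 (mul_le_sq_add_sq_div hb z.re x)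
    _ = C * Real.exp (z.re ^ 2 / (4 * b)) := integral_mul_const _ _
    _ ≤ Real.exp C * Real.exp (1 / (4 * b) * ‖z‖ ^ 2) := by
        gcongr
        · linarith [Real.add_one_le_exp C]
        · rw [div_eq_mul_one_div, mul_comm]
          exact mul_le_mul_of_nonneg_left (sq_le_sq.2 (by simpa using Complex.abs_re_le_norm z))
            (by positivity)
    _ = _ := (Real.exp_add _ _).symm

theorem complexMGF_neg (hμ : IsLeeYang μ) (z : ℂ) :
    complexMGF (fun x : ℝ => x) (μ : Measure ℝ) (-z) =
      complexMGF (fun x : ℝ => x) (μ : Measure ℝ) z := by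
  conv_rhs => rw [← hμ.symmetric]
  simp only [complexMGF]
  rw [integral_map (by fun_prop) (by fun_prop)]
  simp

/-- A Lee-Yang measure whose characteristic function is at least `1 / 2` on `[-√s, √s]` is
sub-Gaussian with a variance proxy that depends on `s` only. -/
theorem hasSubgaussianMGF (hμ : IsLeeYang μ) {s : ℝ} (hs : 0 < s)
    (hlow : ∀ y : ℝ, y ^ 2 ≤ s →
      1 / 2 ≤ ‖complexMGF (fun x : ℝ => x) (μ : Measure ℝ) (y * Complex.I)‖) :
    HasSubgaussianMGF (fun x : ℝ => x) (Real.toNNReal (2 * Real.log 2 / s)) (μ : Measure ℝ) := by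
  refine ⟨hμ.integrable_exp_mul, fun t => ?_⟩
  rcases eq_or_ne t 0 with rfl | ht
  · simp
  obtain ⟨g, hg, hgf⟩ :=
    (differentiable_complexMGF hμ.integrable_exp_mul).exists_comp_sq_of_even hμ.complexMGF_neg
  obtain ⟨A, B, hA, hB, hAB⟩ := hμ.exists_norm_complexMGF_le
  have hg0 : g 0 = 1 := by
    have := hgf 0
    simpa [complexMGF] using this
  have hgrow : ∀ w, ‖g w‖ ≤ Real.exp (A + B * ‖w‖) := by
    intro w
    obtain ⟨z, rfl⟩ := IsAlgClosed.exists_pow_nat_eq w two_pos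
    rw [hgf, norm_pow]
    exact hAB z
  have hzero : ∀ w, g w = 0 → ∃ a : ℝ, s < a ∧ w = -(a : ℂ) := by
    intro w hw
    obtain ⟨z, rfl⟩ := IsAlgClosed.exists_pow_nat_eq w two_pos
    rw [hgf] at hw
    have hre := hμ.zeros_imaginary z hw
    have hz : z = z.im * Complex.I := by
      apply Complex.ext <;> simp [hre]
    refine ⟨z.im ^ 2, ?_, ?_⟩
    -- A zero with (Im z)² ≤ s would contradict the lower bound 1/2 on the characteristic function.
    · by_contra! h
      have := hlow z.im h
      rw [← hz, hw, norm_zero] at this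
      norm_num at this
    · conv_lhs => rw [hz]
      rw [mul_pow, Complex.I_sq]
      push_cast
      ring
  have ht2 : 0 < t ^ 2 := by positivity
  have key := hg.log_norm_div_add_log_norm_div_nonpos hg0 hA hB hgrow hs hzero ht2
  have e1 : ‖g ((t ^ 2 : ℝ) : ℂ)‖ = mgf (fun x : ℝ => x) (μ : Measure ℝ) t := by
    rw [Complex.ofReal_pow, hgf, complexMGF_ofReal, Complex.norm_real,
      Real.norm_of_nonneg mgf_nonneg]
  have e2 : ((-s : ℝ) : ℂ) = ((Real.sqrt s : ℝ) * Complex.I) ^ 2 := by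
    rw [mul_pow, Complex.I_sq, ← Complex.ofReal_pow, Real.sq_sqrt hs.le]
    push_cast
    ring
  rw [e1, e2, hgf] at key
  have h2 : Real.log (1 / 2) ≤ Real.log ‖complexMGF (fun x : ℝ => x) (μ : Measure ℝ)
      ((Real.sqrt s : ℝ) * Complex.I)‖ :=
    Real.log_le_log (by norm_num) (hlow _ (Real.sq_sqrt hs.le).le)
  rw [one_div, Real.log_inv] at h2
  have h3 : -Real.log 2 / s ≤ Real.log ‖complexMGF (fun x : ℝ => x) (μ : Measure ℝ)
      ((Real.sqrt s : ℝ) * Complex.I)‖ / s := by gcongr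
  -- That is, E exp(tX) ≤ exp(t² log 2 / s), variance proxy 2 log 2 / s.
  have h4 : Real.log (mgf (fun x : ℝ => x) (μ : Measure ℝ) t) / t ^ 2 ≤ Real.log 2 / s := by
    rw [neg_div] at h3
    linarith
  rw [div_le_iff₀ ht2] at h4
  have hpos : 0 < mgf (fun x : ℝ => x) (μ : Measure ℝ) t := mgf_pos (hμ.integrable_exp_mul t)
  have hlog2 : 0 ≤ 2 * Real.log 2 / s := by
    have := Real.log_nonneg (one_le_two (α := ℝ))
    positivity
  rw [Real.coe_toNNReal _ hlog2, ← Real.log_le_iff_le_exp hpos]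
  refine h4.trans (le_of_eq ?_)
  ring

end IsLeeYang

/-! ### Passage to the weak limit -/

/-- Along a weakly convergent sequence, the characteristic functions are eventually at least
`1 / 2` on a fixed neighbourhood of the origin. -/
theorem exists_pos_eventually_half_le_norm_complexMGF {μs : ℕ → ProbabilityMeasure ℝ}
    {μ : ProbabilityMeasure ℝ} (hlim : Tendsto μs atTop (𝓝 μ)) :
    ∃ s : ℝ, 0 < s ∧ ∀ᶠ n in atTop, ∀ y : ℝ, y ^ 2 ≤ s →
      1 / 2 ≤ ‖complexMGF (fun x : ℝ => x) (μs n : Measure ℝ) (y * Complex.I)‖ := by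
  have hnonneg : ∀ k : ℕ, ∀ x : ℝ, 0 ≤ min (1 / ((k : ℝ) + 1) * x ^ 2 / 2) 2 := fun k x => by
    positivity
  -- φ_k dominates 1 - cos(yx) for all y² ≤ 1/(k+1) at once, so one test function gives uniformity
  -- in y.
  let φ : ℕ → BoundedContinuousFunction ℝ ℝ := fun k =>
    BoundedContinuousFunction.ofNormedAddCommGroup
      (fun x : ℝ => min (1 / ((k : ℝ) + 1) * x ^ 2 / 2) 2) (by fun_prop) 2 fun x => by
        rw [Real.norm_of_nonneg (hnonneg k x)]
        exact min_le_right _ _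
  have hφ : ∀ k x, φ k x = min (1 / ((k : ℝ) + 1) * x ^ 2 / 2) 2 := fun _ _ => rfl
  have hφ0 : Tendsto (fun k => ∫ x, φ k x ∂(μ : Measure ℝ)) atTop
      (𝓝 (∫ _, (0 : ℝ) ∂(μ : Measure ℝ))) := by
    refine tendsto_integral_of_dominated_convergence (fun _ => (2 : ℝ))
      (fun k => (φ k).continuous.aestronglyMeasurable) (integrable_const _)
      (fun k => .of_forall fun x => ?_) (.of_forall fun x => ?_)
    · rw [hφ, Real.norm_of_nonneg (hnonneg k x)]
      exact min_le_right _ _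
    · have h1 : Tendsto (fun k : ℕ => min (1 / ((k : ℝ) + 1) * x ^ 2 / 2) 2) atTop
          (𝓝 (min (0 * x ^ 2 / 2) 2)) :=
        ((tendsto_one_div_add_atTop_nhds_zero_nat.mul_const _).div_const _).min tendsto_const_nhds
      simp only [hφ]
      simpa using h1
  rw [integral_zero] at hφ0
  obtain ⟨k, hk⟩ := (hφ0.eventually (gt_mem_nhds (show (0 : ℝ) < 1 / 2 by norm_num))).exists
  refine ⟨1 / ((k : ℝ) + 1), by positivity, ?_⟩
  have hk' := (ProbabilityMeasure.tendsto_iff_forall_integral_tendsto.1 hlim (φ k)).eventually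
    (gt_mem_nhds hk)
  filter_upwards [hk'] with n hn y hy
  have hre : (complexMGF (fun x : ℝ => x) (μs n : Measure ℝ) (y * Complex.I)).re =
      ∫ x : ℝ, Real.cos (y * x) ∂(μs n : Measure ℝ) := by
    have hint : Integrable (fun x : ℝ => Complex.exp (y * Complex.I * x)) (μs n : Measure ℝ) := by
      refine (integrable_const (1 : ℝ)).mono' (by fun_prop) (.of_forall fun x => ?_)
      rw [Complex.norm_exp]
      simp
    rw [complexMGF, ← Complex.reCLM_apply, ← ContinuousLinearMap.integral_comp_comm _ hint]
    refine integral_congr_ae (.of_forall fun x => ?_)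
    simp only [Complex.reCLM_apply]
    rw [show (y : ℂ) * Complex.I * x = ((y * x : ℝ) : ℂ) * Complex.I by push_cast; ring,
      Complex.exp_ofReal_mul_I_re]
  have hcos : Integrable (fun x : ℝ => Real.cos (y * x)) (μs n : Measure ℝ) :=
    (integrable_const (1 : ℝ)).mono' (by fun_prop)
      (.of_forall fun x => by simpa using Real.abs_cos_le_one _)
  have hle : ∫ x : ℝ, (1 - φ k x) ∂(μs n : Measure ℝ) ≤
      ∫ x : ℝ, Real.cos (y * x) ∂(μs n : Measure ℝ) := by
    refine integral_mono ((integrable_const _).sub ((φ k).integrable _)) hcos fun x => ?_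
    simp only [hφ]
    have h1 := Real.one_sub_sq_div_two_le_cos (x := y * x)
    have h2 := Real.neg_one_le_cos (y * x)
    have h3 : (y * x) ^ 2 ≤ 1 / ((k : ℝ) + 1) * x ^ 2 := by
      rw [mul_pow]; gcongr
    rcases min_choice (1 / ((k : ℝ) + 1) * x ^ 2 / 2) 2 with h | h <;> rw [h] <;> linarith
  rw [integral_sub (integrable_const _) ((φ k).integrable _)] at hle
  simp only [integral_const, probReal_univ, smul_eq_mul, mul_one] at hle
  refine le_trans ?_ (Complex.re_le_norm _)
  rw [hre]
  linarith

/-- Sub-Gaussianity with a fixed variance proxy passes to weak limits. -/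
theorem hasSubgaussianMGF_of_tendsto {μs : ℕ → ProbabilityMeasure ℝ} {μ : ProbabilityMeasure ℝ}
    (hlim : Tendsto μs atTop (𝓝 μ)) {c : NNReal}
    (hsub : ∀ n, HasSubgaussianMGF (fun x : ℝ => x) c (μs n : Measure ℝ)) :
    HasSubgaussianMGF (fun x : ℝ => x) c (μ : Measure ℝ) := by
  have hlin : ∀ t : ℝ, ∫⁻ x : ℝ, ENNReal.ofReal (Real.exp (t * x)) ∂(μ : Measure ℝ) ≤
      ENNReal.ofReal (Real.exp (c * t ^ 2 / 2)) := by
    intro t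
    -- Fatou's lemma for weak convergence, through the portmanteau inequality for open sets.
    refine (lintegral_le_liminf_lintegral_of_forall_isOpen_measure_le_liminf_measure
      (f := fun x : ℝ => Real.exp (t * x)) (by fun_prop) (fun x => (Real.exp_pos _).le)
      fun G hG => ProbabilityMeasure.le_liminf_measure_open_of_tendsto hlim hG).trans ?_
    refine liminf_le_of_le ⟨0, .of_forall (by simp)⟩ fun b hb => ?_
    obtain ⟨n, hn⟩ := hb.exists
    refine hn.trans ?_
    rw [← ofReal_integral_eq_lintegral_ofReal ((hsub n).integrable_exp_mul t)
      (.of_forall fun x => (Real.exp_pos _).le)]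
    exact ENNReal.ofReal_le_ofReal ((hsub n).mgf_le t)
  have hint : ∀ t : ℝ, Integrable (fun x : ℝ => Real.exp (t * x)) (μ : Measure ℝ) := fun t =>
    (lintegral_ofReal_ne_top_iff_integrable (by fun_prop)
      (.of_forall fun x => (Real.exp_pos _).le)).1 ((hlin t).trans_lt ENNReal.ofReal_lt_top).ne
  refine ⟨hint, fun t => ?_⟩
  have := hlin t
  rw [← ofReal_integral_eq_lintegral_ofReal (hint t)
    (.of_forall fun x => (Real.exp_pos _).le)] at this
  exact (ENNReal.ofReal_le_ofReal_iff (Real.exp_pos _).le).1 this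

/-- A sub-Gaussian law integrates `exp (b x²)` for some `b > 0`. -/
theorem ProbabilityTheory.HasSubgaussianMGF.exists_integrable_exp_mul_sq {μ : Measure ℝ}
    [IsProbabilityMeasure μ] {c : NNReal} (h : HasSubgaussianMGF (fun x : ℝ => x) c μ) :
    ∃ b : ℝ, 0 < b ∧ Integrable (fun x : ℝ => Real.exp (b * x ^ 2)) μ := by
  -- Up to a constant, exp(x²/(4d)) is the integral of exp(tx - dt²) over t. After Tonelli the bound
  -- exp(ct²/2) leaves exp(-t²), thanks to the `+ 1`.
  set d : ℝ := c / 2 + 1 with hd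
  have hd0 : 0 < d := by positivity
  refine ⟨1 / (4 * d), by positivity, ?_⟩
  rw [← lintegral_ofReal_ne_top_iff_integrable (by fun_prop)
    (.of_forall fun x => (Real.exp_pos _).le)]
  set K : ENNReal := ∫⁻ t : ℝ, ENNReal.ofReal (Real.exp (-d * t ^ 2)) with hK
  have hK0 : K ≠ 0 := by
    rw [hK, ← ofReal_integral_eq_lintegral_ofReal (integrable_exp_neg_mul_sq hd0)
      (.of_forall fun x => (Real.exp_pos _).le), integral_gaussian]
    have : 0 < Real.sqrt (Real.pi / d) := by positivity
    simpa using this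
  have hinner : ∀ x : ℝ, ∫⁻ t : ℝ, ENNReal.ofReal (Real.exp (t * x - d * t ^ 2)) =
      ENNReal.ofReal (Real.exp (1 / (4 * d) * x ^ 2)) * K := by
    intro x
    rw [hK, ← lintegral_const_mul' _ _ ENNReal.ofReal_ne_top,
      ← lintegral_add_right_eq_self _ (x / (2 * d))]
    refine lintegral_congr fun t => ?_
    rw [← ENNReal.ofReal_mul (Real.exp_pos _).le, ← Real.exp_add]
    congr 2
    field_simp
    ring
  have hfub : ∫⁻ x : ℝ, ENNReal.ofReal (Real.exp (1 / (4 * d) * x ^ 2)) * K ∂μ < ⊤ := by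
    simp only [← hinner]
    rw [lintegral_lintegral_swap (by fun_prop)]
    calc ∫⁻ t : ℝ, ∫⁻ x : ℝ, ENNReal.ofReal (Real.exp (t * x - d * t ^ 2)) ∂μ
        ≤ ∫⁻ t : ℝ, ENNReal.ofReal (Real.exp (-1 * t ^ 2)) := by
          refine lintegral_mono fun t => ?_
          have e : ∀ x : ℝ, ENNReal.ofReal (Real.exp (t * x - d * t ^ 2)) =
              ENNReal.ofReal (Real.exp (-d * t ^ 2)) * ENNReal.ofReal (Real.exp (t * x)) := by
            intro x
            rw [← ENNReal.ofReal_mul (Real.exp_pos _).le, ← Real.exp_add]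
            congr 2
            ring
          simp only [e]
          rw [lintegral_const_mul' _ _ ENNReal.ofReal_ne_top,
            ← ofReal_integral_eq_lintegral_ofReal (h.integrable_exp_mul t)
              (.of_forall fun x => (Real.exp_pos _).le), ← ENNReal.ofReal_mul (Real.exp_pos _).le]
          refine ENNReal.ofReal_le_ofReal ?_
          refine (mul_le_mul_of_nonneg_left (h.mgf_le t) (Real.exp_pos _).le).trans (le_of_eq ?_)
          rw [← Real.exp_add]
          congr 1
          rw [hd]
          ring
      _ < ⊤ := by
          refine lt_top_iff_ne_top.2 ?_
          exact (lintegral_ofReal_ne_top_iff_integrable (by fun_prop)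
            (.of_forall fun x => (Real.exp_pos _).le)).2 (integrable_exp_neg_mul_sq one_pos)
  rw [lintegral_mul_const _ (by fun_prop)] at hfub
  intro htop
  rw [htop, ENNReal.top_mul hK0] at hfub
  exact lt_irrefl _ hfub

/-- Sub-Gaussian laws have uniformly small truncation errors for `exp (z x)`. -/
theorem ProbabilityTheory.HasSubgaussianMGF.norm_integral_exp_sub_truncation_le {μ : Measure ℝ}
    [IsProbabilityMeasure μ] {c : NNReal} (h : HasSubgaussianMGF (fun x : ℝ => x) c μ) (z : ℂ)
    {A : ℝ} (hA : 0 ≤ A) :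
    ‖complexMGF (fun x : ℝ => x) μ z -
        ∫ x : ℝ, Complex.exp (z * ((max (-A) (min x A) : ℝ) : ℂ)) ∂μ‖ ≤
      4 * Real.exp (c * (‖z‖ + 1) ^ 2 / 2) * Real.exp (-A) := by
  have hexp : ∀ x : ℝ, ‖Complex.exp (z * x)‖ ≤ Real.exp (‖z‖ * |x|) := fun x => by
    rw [Complex.norm_exp]
    refine Real.exp_le_exp.2 ((Complex.re_le_norm _).trans (le_of_eq ?_))
    rw [norm_mul, Complex.norm_real, Real.norm_eq_abs]
  have habs : ∀ x : ℝ, |max (-A) (min x A)| ≤ |x| := fun x => by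
    rw [abs_le]
    constructor
    · rcases le_total x A with hxA | hxA
      · rw [min_eq_left hxA]; exact (neg_abs_le x).trans (le_max_right _ _)
      · rw [min_eq_right hxA]
        linarith [le_max_right (-A) A, abs_nonneg x]
    · refine max_le (by linarith [abs_nonneg x]) ((min_le_left _ _).trans (le_abs_self x))
  have hbA : ∀ x : ℝ, |max (-A) (min x A)| ≤ A := fun x =>
    abs_le.2 ⟨le_max_left _ _, max_le (by linarith) (min_le_right _ _)⟩
  have hcont : Continuous fun x : ℝ => Complex.exp (z * ((max (-A) (min x A) : ℝ) : ℂ)) := by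
    fun_prop
  have hint1 : Integrable (fun x : ℝ => Complex.exp (z * x)) μ := by
    rw [← integrable_norm_iff (by fun_prop)]
    simpa [Complex.norm_exp] using h.integrable_exp_mul z.re
  have hint2 : Integrable (fun x : ℝ => Complex.exp (z * ((max (-A) (min x A) : ℝ) : ℂ))) μ := by
    refine (integrable_const (Real.exp (‖z‖ * A))).mono' hcont.aestronglyMeasurable
      (.of_forall fun x => (hexp _).trans (Real.exp_le_exp.2 ?_))
    exact mul_le_mul_of_nonneg_left (hbA x) (norm_nonneg z)
  -- The extra unit in the exponent yields the factor exp(-A) where |x| > A.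
  set t := ‖z‖ + 1 with ht
  have hmaj : Integrable (fun x : ℝ =>
      (Real.exp (t * x) + Real.exp (-t * x)) * (2 * Real.exp (-A))) μ :=
    ((h.integrable_exp_mul t).add (h.integrable_exp_mul (-t))).mul_const _
  rw [complexMGF, ← integral_sub hint1 hint2]
  calc ‖∫ x : ℝ, (Complex.exp (z * x) - Complex.exp (z * ((max (-A) (min x A) : ℝ) : ℂ))) ∂μ‖
      ≤ ∫ x : ℝ, (Real.exp (t * x) + Real.exp (-t * x)) * (2 * Real.exp (-A)) ∂μ := by
        refine norm_integral_le_of_norm_le hmaj (.of_forall fun x => ?_)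
        rcases le_or_gt |x| A with hx | hx
        · rw [abs_le] at hx
          rw [min_eq_left hx.2, max_eq_right hx.1, sub_self, norm_zero]
          positivity
        · have h1 := hexp x
          have h2 := (hexp (max (-A) (min x A))).trans
            (Real.exp_le_exp.2 (mul_le_mul_of_nonneg_left (habs x) (norm_nonneg z)))
          have h3 : Real.exp (‖z‖ * |x|) ≤ Real.exp (t * |x|) * Real.exp (-A) := by
            rw [← Real.exp_add, Real.exp_le_exp, ht]
            linarith
          have h4 : Real.exp (t * |x|) ≤ Real.exp (t * x) + Real.exp (-t * x) := by
            rcases abs_choice x with h | h <;> rw [h]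
            · linarith [Real.exp_pos (-t * x)]
            · rw [mul_neg, ← neg_mul]
              linarith [Real.exp_pos (t * x)]
          have h5 := mul_le_mul_of_nonneg_right h4 (Real.exp_pos (-A)).le
          linarith [norm_sub_le (Complex.exp (z * x))
            (Complex.exp (z * ((max (-A) (min x A) : ℝ) : ℂ)))]
    _ = (mgf (fun x : ℝ => x) μ t + mgf (fun x : ℝ => x) μ (-t)) * (2 * Real.exp (-A)) := by
        rw [integral_mul_const, integral_add (h.integrable_exp_mul t) (h.integrable_exp_mul (-t))]
        rfl
    _ ≤ (Real.exp (c * t ^ 2 / 2) + Real.exp (c * t ^ 2 / 2)) * (2 * Real.exp (-A)) := by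
        have h2 := h.mgf_le (-t)
        rw [neg_sq] at h2
        gcongr
        exact h.mgf_le t
    _ = _ := by ring

/-- For uniformly sub-Gaussian laws, weak convergence implies pointwise convergence of the moment
generating functions. -/
theorem tendsto_complexMGF_of_hasSubgaussianMGF {μs : ℕ → ProbabilityMeasure ℝ}
    {μ : ProbabilityMeasure ℝ} (hlim : Tendsto μs atTop (𝓝 μ)) {c : NNReal}
    (hsub : ∀ n, HasSubgaussianMGF (fun x : ℝ => x) c (μs n : Measure ℝ))
    (hμ : HasSubgaussianMGF (fun x : ℝ => x) c (μ : Measure ℝ)) (z : ℂ) :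
    Tendsto (fun n => complexMGF (fun x : ℝ => x) (μs n : Measure ℝ) z) atTop
      (𝓝 (complexMGF (fun x : ℝ => x) (μ : Measure ℝ) z)) := by
  have herr : Tendsto (fun A : ℝ => 4 * Real.exp (c * (‖z‖ + 1) ^ 2 / 2) * Real.exp (-A)) atTop
      (𝓝 0) := by
    simpa using Real.tendsto_exp_neg_atTop_nhds_zero.const_mul
      (4 * Real.exp (c * (‖z‖ + 1) ^ 2 / 2))
  rw [Metric.tendsto_atTop']
  intro ε hε
  obtain ⟨A, hAε, hA⟩ := ((herr.eventually (gt_mem_nhds (show 0 < ε / 3 by positivity))).and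
    (eventually_ge_atTop 0)).exists
  have hbA : ∀ x : ℝ, |max (-A) (min x A)| ≤ A := fun x =>
    abs_le.2 ⟨le_max_left _ _, max_le (by linarith) (min_le_right _ _)⟩
  let φ : BoundedContinuousFunction ℝ ℂ := BoundedContinuousFunction.ofNormedAddCommGroup
    (fun x : ℝ => Complex.exp (z * ((max (-A) (min x A) : ℝ) : ℂ))) (by fun_prop)
    (Real.exp (‖z‖ * A)) fun x => by
      rw [Complex.norm_exp]
      refine Real.exp_le_exp.2 ((Complex.re_le_norm _).trans ?_)
      rw [norm_mul, Complex.norm_real, Real.norm_eq_abs]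
      exact mul_le_mul_of_nonneg_left (hbA x) (norm_nonneg z)
  have hφ := (ProbabilityMeasure.tendsto_iff_forall_integral_rclike_tendsto ℂ).1 hlim φ
  obtain ⟨N, hN⟩ := Metric.tendsto_atTop'.1 hφ (ε / 3) (by positivity)
  refine ⟨N, fun n hn => ?_⟩
  have h1 := (hsub n).norm_integral_exp_sub_truncation_le z hA
  have h2 := hμ.norm_integral_exp_sub_truncation_le z hA
  have h3 := hN n hn
  rw [← dist_eq_norm] at h1 h2
  rw [dist_comm] at h2
  refine (dist_triangle4 _ (∫ x, φ x ∂(μs n : Measure ℝ)) (∫ x, φ x ∂(μ : Measure ℝ)) _).trans_lt ?_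
  rw [show ε = ε / 3 + ε / 3 + ε / 3 by ring]
  exact add_lt_add (add_lt_add (h1.trans_lt hAε) h3) (h2.trans_lt hAε)

theorem map_neg_eq_of_tendsto {μs : ℕ → ProbabilityMeasure ℝ} {μ : ProbabilityMeasure ℝ}
    (hlim : Tendsto μs atTop (𝓝 μ))
    (hsymm : ∀ n, (μs n : Measure ℝ).map (fun x : ℝ => -x) = (μs n : Measure ℝ)) :
    (μ : Measure ℝ).map (fun x : ℝ => -x) = (μ : Measure ℝ) := by
  have h1 := ProbabilityMeasure.tendsto_map_of_tendsto_of_continuous μs μ hlim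
    (continuous_neg (G := ℝ))
  have h2 : (fun n => (μs n).map (continuous_neg (G := ℝ)).measurable.aemeasurable) = μs := by
    funext n
    exact Subtype.ext (hsymm n)
  rw [h2] at h1
  have h3 : μ.map (continuous_neg (G := ℝ)).measurable.aemeasurable = μ :=
    tendsto_nhds_unique h1 hlim
  exact congrArg ProbabilityMeasure.toMeasure h3

/-! ### The closure theorem -/

theorem mainTheorem1 (μs : ℕ → ProbabilityMeasure ℝ) (μ : ProbabilityMeasure ℝ)
    (hμs : ∀ n, μs n ∈ leeYangClass) (hlim : Tendsto μs atTop (𝓝 μ)) :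
    μ ∈ leeYangClass ∧
      ∃ c : ℝ, 0 < c ∧ ∀ r : ℝ, 0 ≤ r →
        (μ : Measure ℝ) (Set.Ioi r) ≤ ENNReal.ofReal (Real.exp (-c * r ^ 2)) := by
  obtain ⟨s, hs, hev⟩ := exists_pos_eventually_half_le_norm_complexMGF hlim
  obtain ⟨N, hN⟩ := eventually_atTop.1 hev
  -- Only a tail has the uniform lower bound; it has the same limit.
  set νs : ℕ → ProbabilityMeasure ℝ := fun n => μs (n + N) with hνs
  have hνlim : Tendsto νs atTop (𝓝 μ) := (tendsto_add_atTop_iff_nat N).2 hlim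
  have hLY : ∀ n, IsLeeYang (νs n) := fun n => hμs (n + N)
  set c : NNReal := Real.toNNReal (2 * Real.log 2 / s) with hc
  have hc0 : (0 : ℝ) < c := by
    have := Real.log_pos (one_lt_two (α := ℝ))
    rw [hc, NNReal.coe_pos, Real.toNNReal_pos]
    positivity
  have hsub : ∀ n, HasSubgaussianMGF (fun x : ℝ => x) c (νs n : Measure ℝ) := fun n =>
    (hLY n).hasSubgaussianMGF hs (hN (n + N) (Nat.le_add_left N n))
  have hμ := hasSubgaussianMGF_of_tendsto hνlim hsub
  have hbd : ∀ r : ℝ, ∃ M : ℝ, ∀ n z, ‖z‖ ≤ r →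
      ‖complexMGF (fun x : ℝ => x) (νs n : Measure ℝ) z‖ ≤ M := by
    refine fun r => ⟨Real.exp (c * r ^ 2 / 2), fun n z hz => ?_⟩
    refine norm_complexMGF_le_mgf.trans (((hsub n).mgf_le _).trans (Real.exp_le_exp.2 ?_))
    have : z.re ^ 2 ≤ r ^ 2 :=
      sq_le_sq.2 (((Complex.abs_re_le_norm z).trans hz).trans (le_abs_self r))
    gcongr
  -- The constant 1/(2c) is the Chernoff exponent for variance proxy c.
  refine ⟨⟨?_, hμ.exists_integrable_exp_mul_sq, fun z hz => ?_⟩, 1 / (2 * c), by positivity,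
    fun r hr => ?_⟩
  · exact map_neg_eq_of_tendsto hνlim fun n => (hLY n).symmetric
  · by_contra hre
    -- The value 1 at the origin excludes the identically zero limit in Hurwitz's theorem.
    have h0 : complexMGF (fun x : ℝ => x) (μ : Measure ℝ) 0 ≠ 0 := by simp [complexMGF]
    exact Complex.ne_zero_of_tendsto_of_ne_zero
      (fun n => differentiable_complexMGF (hsub n).integrable_exp_mul)
      (differentiable_complexMGF hμ.integrable_exp_mul)
      (tendsto_complexMGF_of_hasSubgaussianMGF hνlim hsub hμ) hbd
      (isOpen_ne_fun Complex.continuous_re continuous_const)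
      (fun n z hz h => hz ((hLY n).zeros_imaginary z h)) h0 (z := z) hre hz
  · have h1 := hμ.measure_ge_le hr
    have h2 : (μ : Measure ℝ) (Set.Ioi r) ≤ (μ : Measure ℝ) {x : ℝ | r ≤ x} :=
      measure_mono fun x (hx : r < x) => hx.le
    refine h2.trans ?_
    rw [← ofReal_measureReal]
    refine ENNReal.ofReal_le_ofReal (h1.trans (le_of_eq ?_))
    congr 1
    ring
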